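/- Let $G$ be a discrete group with identity $\varepsilon$, let $X$ be a totally disconnected locally compact Hausdorff space, and let $K$ be a field. Let $\phi=(\phi_g,X_g,X)_{g\in G}$ be a partial action of $G$ on $X$: each $X_g\subseteq X$ is open, each $\phi_g:X_{g^{-1}}\to X_g$ is a homeomorphism, $X_\varepsilon=X$, $\phi_\varepsilon=\mathrm{id}_X$, $\phi_g(X_{g^{-1}}\cap X_h)=X_g\cap X_{gh}$ for all $g,h\in G$, and $\phi_g(\phi_h(x))=\phi_{gh}(x)$ for all $g,h\in G$ and $x\in X_{h^{-1}}\cap X_{h^{-1}g^{-1}}$. Assume that every $X_g$ is clopen in $X$. Let $\mathcal G_X=\bigcup_{g\in G}\{g\}\times X_g$, with the topology inherited from $G\times X$, be the ample Hausdorff groupoid with $r(g,x)=(\varepsilon,x)$, $d(g,x)=(\varepsilon,\phi_{g^{-1}}(x))$, $(g,x)(h,y)=(gh,x)$ whenever $d(g,x)=r(h,y)$, and $(g,x)^{-1}=(g^{-1},\phi_{g^{-1}}(x))$. Its Steinberg algebra $A_K(\mathcal G_X)$ is the $K$-algebra of compactly supported locally constant functions $\mathcal G_X\to K$ with pointwise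 addition and the convolution product $(f*f')(\gamma)=\sum_{\alpha\beta=\gamma}f(\alpha)f'(\beta)$, graded by $G$ with homogeneous components $A_K(\mathcal G_X)_g=\{f:\operatorname{supp} f\subseteq\{g\}\times X_g\}$. A two-sided ideal $I$ of $A_K(\mathcal G_X)$ is graded if $I=\bigoplus_{g\in G}\bigl(I\cap A_K(\mathcal G_X)_g\bigr)$. A subset $V\subseteq X$ is invariant if $\phi_g(V\cap X_{g^{-1}})\subseteq V$ for all $g\in G$. If $V$ is open and invariant, let $\mathcal G_V=\bigcup_{g\in G}\{g\}\times(V\cap X_g)$ be the groupoid of the restricted partial action $(\phi_g, V\cap X_g,V)_{g\in G}$; its Steinberg algebra $A_K(\mathcal G_V)$ is regarded as a subalgebra of $A_K(\mathcal G_X)$ through extension of functions by zero. Then, for every open invariant subset $V\subseteq X$, $A_K(\mathcal G_V)$ is a graded ideal of $A_K(\mathcal G_X)$, and $$V\longmapsto A_K(\mathcal G_V)$$ is a bijection from the set of open invariant subsets of $X$ onto the set of graded ideals of $A_K(\mathcal G_X)$. -/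

import Mathlib

/-! # Topological groupoids, described by their arrows -/

/-- A groupoid given by its set `Γ` of arrows: `src a` and `rng a` are the units `d(a) = a⁻¹a` and
`r(a) = aa⁻¹`, and `comp a b h` is the product `ab`, which exists exactly when `d(a) = r(b)`. -/
class ArrowGroupoid (Γ : Type*) where
  src : Γ → Γ
  rng : Γ → Γ
  inv : Γ → Γ
  comp : ∀ a b : Γ, src a = rng b → Γ
  src_src : ∀ a, src (src a) = src a
  rng_src : ∀ a, rng (src a) = src a
  src_rng : ∀ a, src (rng a) = rng a
  rng_rng : ∀ a, rng (rng a) = rng a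
  src_comp : ∀ a b h, src (comp a b h) = src b
  rng_comp : ∀ a b h, rng (comp a b h) = rng a
  assoc : ∀ a b c (h : src a = rng b) (h' : src b = rng c),
    comp (comp a b h) c ((src_comp a b h).trans h') =
      comp a (comp b c h') (h.trans (rng_comp b c h').symm)
  comp_src : ∀ a, comp a (src a) (rng_src a).symm = a
  rng_comp_self : ∀ a, comp (rng a) a (src_rng a) = a
  src_inv : ∀ a, src (inv a) = rng a
  rng_inv : ∀ a, rng (inv a) = src a
  inv_comp : ∀ a, comp (inv a) a (src_inv a) = src a
  comp_inv : ∀ a, comp a (inv a) (rng_inv a).symm = rng a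

namespace ArrowGroupoid

variable {Γ : Type*} [ArrowGroupoid Γ]

variable (Γ) in
/-- The unit space `d(Γ)`, which is also `r(Γ)`. -/
def unitSpace : Set Γ := Set.range (src : Γ → Γ)

/-- The domain map `d : Γ → Γ⁰`. -/
def srcUnit (a : Γ) : unitSpace Γ := ⟨src a, a, rfl⟩

/-- The range map `r : Γ → Γ⁰`. -/
def rngUnit (a : Γ) : unitSpace Γ := ⟨rng a, rng a, src_rng a⟩

/-- The product `UV = {ab : a ∈ U, b ∈ V, d(a) = r(b)}` of two sets of arrows. -/
def setMul (U V : Set Γ) : Set Γ :=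
  {γ | ∃ a ∈ U, ∃ b ∈ V, ∃ h : src a = rng b, comp a b h = γ}

/-- An open bisection: an open set of arrows on which `d` and `r` are homeomorphisms onto open
subsets of the unit space. -/
def IsOpenBisection [TopologicalSpace Γ] (U : Set Γ) : Prop :=
  IsOpen U ∧ Topology.IsOpenEmbedding (U.domRestrict srcUnit) ∧
    Topology.IsOpenEmbedding (U.domRestrict rngUnit)

end ArrowGroupoid

open ArrowGroupoid in
/-- A topological groupoid: inversion and composition are continuous. -/
class TopologicalGroupoid (Γ : Type*) [TopologicalSpace Γ] [ArrowGroupoid Γ] : Prop where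
  continuous_inv : Continuous (inv : Γ → Γ)
  continuous_comp :
    Continuous (fun p : {p : Γ × Γ // src p.1 = rng p.2} => comp p.1.1 p.1.2 p.2)

open ArrowGroupoid in
/-- An ample groupoid: an étale topological groupoid (`d` is a local homeomorphism onto the unit
space) whose topology has a basis of compact open bisections. -/
class AmpleGroupoid (Γ : Type*) [TopologicalSpace Γ] [ArrowGroupoid Γ] : Prop extends
    TopologicalGroupoid Γ where
  etale : IsLocalHomeomorph (srcUnit : Γ → unitSpace Γ)
  basis : TopologicalSpace.IsTopologicalBasis {B : Set Γ | IsCompact B ∧ IsOpenBisection B}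

/-! # The Steinberg algebra of an ample Hausdorff groupoid -/

/-- The space `C_c(Γ, R)` of compactly supported locally constant functions, that is, of compactly
supported continuous functions to the discrete ring `R`. -/
def steinbergSpace (R Γ : Type*) [CommRing R] [TopologicalSpace Γ] :
    Submodule R (Γ → R) where
  carrier := {f | IsLocallyConstant f ∧ HasCompactSupport f}
  zero_mem' := ⟨IsLocallyConstant.const 0, HasCompactSupport.zero⟩
  add_mem' hf hg := ⟨hf.1.add hg.1, hf.2.add hg.2⟩
  smul_mem' c _ hf := ⟨hf.1.comp (fun t => c • t), hf.2.comp_left (g := fun t => c • t) (smul_zero c)⟩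

theorem indicator_mem_steinbergSpace {R Γ : Type*} [CommRing R] [TopologicalSpace Γ] [T2Space Γ] {B : Set Γ} (hc : IsCompact B) (ho : IsOpen B) :
    B.indicator (1 : Γ → R) ∈ steinbergSpace R Γ := by
  classical
  refine ⟨?_, HasCompactSupport.intro hc fun x hx => Set.indicator_of_notMem hx _⟩
  rw [IsLocallyConstant.iff_exists_open]
  intro x
  by_cases hx : x ∈ B
  · exact ⟨B, ho, hx, fun y hy => by simp [hx, hy]⟩
  · exact ⟨Bᶜ, hc.isClosed.isOpen_compl, hx, fun y hy => by
      have hy' : y ∉ B := hy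
      simp [hx, hy']⟩

theorem isCompact_support_of_mem {R Γ : Type*} [CommRing R] [TopologicalSpace Γ] {f : Γ → R} (hf : f ∈ steinbergSpace R Γ) :
    IsCompact (Function.support f) := by
  have : IsClosed (Function.support f) := by
    rw [← isOpen_compl_iff]
    have := hf.1 {0}
    convert this using 1
    ext x
    simp
  have h2 := hf.2
  rwa [HasCompactSupport, tsupport, this.closure_eq] at h2

namespace ArrowGroupoid

variable {R Γ : Type*} [CommRing R] [ArrowGroupoid Γ]

/-- The convolution `(f * g)(γ) = ∑_{ab = γ} f(a) g(b)`. -/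
noncomputable def convolution (f g : Γ → R) (γ : Γ) : R :=
  ∑ᶠ p : {p : Γ × Γ // ∃ h : src p.1 = rng p.2, comp p.1 p.2 h = γ}, f p.1.1 * g p.1.2

theorem inv_comp_comp {a b : Γ} (h : src a = rng b) :
    comp (inv a) (comp a b h) ((src_inv a).trans (rng_comp a b h).symm) = b := by
  rw [← assoc (inv a) a b (src_inv a) h]
  have : ∀ (x : Γ) (hx : src x = rng b), x = rng b → comp x b hx = b := by
    rintro x hx rfl
    exact rng_comp_self b
  exact this _ _ ((inv_comp a).trans h)

theorem comp_inv_comp {a b : Γ} (h : rng a = rng b) :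
    comp a (comp (inv a) b ((src_inv a).trans h))
      ((rng_inv a).symm.trans (rng_comp _ _ _).symm) = b := by
  rw [← assoc a (inv a) b (rng_inv a).symm ((src_inv a).trans h)]
  have : ∀ (x : Γ) (hx : src x = rng b), x = rng b → comp x b hx = b := by
    rintro x hx rfl
    exact rng_comp_self b
  exact this _ _ ((comp_inv a).trans h)

theorem comp_left_cancel {a b b' : Γ} (h : src a = rng b) (h' : src a = rng b')
    (e : comp a b h = comp a b' h') : b = b' := by
  rw [← inv_comp_comp h, ← inv_comp_comp h']
  congr 1

theorem convolution_indicator {U V : Set Γ} (hU : Set.InjOn rng U) :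
    convolution (U.indicator (1 : Γ → R)) (V.indicator 1) = (setMul U V).indicator 1 := by
  classical
  funext γ
  by_cases hγ : γ ∈ setMul U V
  · obtain ⟨a, ha, b, hb, h, rfl⟩ := hγ
    have hm : comp a b h ∈ setMul U V := ⟨a, ha, b, hb, h, rfl⟩
    unfold convolution
    rw [finsum_eq_single _ ⟨(a, b), h, rfl⟩]
    · simp [ha, hb, hm]
    · rintro ⟨⟨a', b'⟩, h', e⟩ hne
      by_cases ha' : a' ∈ U
      · exfalso
        have : a' = a := hU ha' ha (by
          rw [← rng_comp a' b' h', ← rng_comp a b h]; exact congrArg rng e)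
        subst this
        have : b' = b := comp_left_cancel h' h e
        subst this
        exact hne rfl
      · simp [ha']
  · rw [Set.indicator_of_notMem hγ]
    unfold convolution
    rw [finsum_eq_zero_of_forall_eq_zero]
    rintro ⟨⟨a', b'⟩, h', e⟩
    by_cases ha' : a' ∈ U
    · by_cases hb' : b' ∈ V
      · exact (hγ ⟨a', ha', b', hb', h', e⟩).elim
      · simp [hb']
    · simp [ha']

theorem setMul_assoc (U V W : Set Γ) : setMul (setMul U V) W = setMul U (setMul V W) := by
  ext γ
  constructor
  · rintro ⟨_, ⟨a, ha, b, hb, h, rfl⟩, c, hc, h', rfl⟩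
    have k : src b = rng c := (src_comp a b h).symm.trans h'
    exact ⟨a, ha, comp b c k, ⟨b, hb, c, hc, k, rfl⟩, h.trans (rng_comp b c k).symm,
      (assoc a b c h k).symm⟩
  · rintro ⟨a, ha, _, ⟨b, hb, c, hc, k, rfl⟩, h', rfl⟩
    have h : src a = rng b := h'.trans (rng_comp b c k)
    exact ⟨comp a b h, ⟨a, ha, b, hb, h, rfl⟩, c, hc, (src_comp a b h).trans k,
      assoc a b c h k⟩

theorem injOn_rng_setMul {U V : Set Γ} (hU : Set.InjOn rng U) (hV : Set.InjOn rng V) :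
    Set.InjOn rng (setMul U V) := by
  rintro _ ⟨a, ha, b, hb, h, rfl⟩ _ ⟨a', ha', b', hb', h', rfl⟩ e
  rw [rng_comp, rng_comp] at e
  obtain rfl := hU ha ha' e
  obtain rfl := hV hb hb' (h.symm.trans h')
  rfl

theorem convolution_zero_left (g : Γ → R) : convolution 0 g = 0 := by
  funext γ
  simp [convolution]

theorem convolution_zero_right (f : Γ → R) : convolution f 0 = 0 := by
  funext γ
  simp [convolution]

variable [TopologicalSpace Γ]

theorem IsOpenBisection.injOn_rng {U : Set Γ} (h : IsOpenBisection U) : Set.InjOn rng U := by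
  intro a ha b hb e
  have := h.2.2.injective (a₁ := ⟨a, ha⟩) (a₂ := ⟨b, hb⟩) (Subtype.ext e)
  exact congrArg Subtype.val this

theorem IsOpenBisection.mono {U V : Set Γ} (h : IsOpenBisection U) (hV : IsOpen V) (hVU : V ⊆ U) :
    IsOpenBisection V := by
  have hi : Topology.IsOpenEmbedding (Set.inclusion hVU) :=
    Topology.IsOpenEmbedding.of_comp _ h.1.isOpenEmbedding_subtypeVal
      (hV.isOpenEmbedding_subtypeVal)
  exact ⟨hV, h.2.1.comp hi, h.2.2.comp hi⟩

section Topological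

variable [TopologicalGroupoid Γ]

theorem continuous_comp_of {Y : Type*} [TopologicalSpace Y] {u v : Y → Γ} (hu : Continuous u)
    (hv : Continuous v) (h : ∀ y, src (u y) = rng (v y)) :
    Continuous (fun y => comp (u y) (v y) (h y)) :=
  TopologicalGroupoid.continuous_comp.comp
    (f := fun y => (⟨(u y, v y), h y⟩ : {p : Γ × Γ // src p.1 = rng p.2})) (by fun_prop)

theorem continuous_src : Continuous (src : Γ → Γ) := by
  have := continuous_comp_of (TopologicalGroupoid.continuous_inv (Γ := Γ)) continuous_id src_inv
  simpa only [id, inv_comp] using this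

theorem continuous_rng : Continuous (rng : Γ → Γ) := by
  have := continuous_src.comp (TopologicalGroupoid.continuous_inv (Γ := Γ))
  simpa only [Function.comp_def, src_inv] using this

theorem isOpen_setMul {U V : Set Γ} (hU : IsOpenBisection U) (hV : IsOpen V) :
    IsOpen (setMul U V) := by
  have hr : Continuous (rngUnit : Γ → unitSpace Γ) := continuous_rng.subtype_mk _
  set e := U.domRestrict (rngUnit : Γ → unitSpace Γ) with he
  have hP : IsOpen ((rngUnit : Γ → unitSpace Γ) ⁻¹' Set.range e) :=
    hU.2.2.isOpen_range.preimage hr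
  set P := (rngUnit : Γ → unitSpace Γ) ⁻¹' Set.range e with hPdef
  let φ := hU.2.2.isEmbedding.toHomeomorph
  let σ : P → U := fun γ => φ.symm ⟨rngUnit γ.1, γ.2⟩
  have hσ : Continuous σ := φ.symm.continuous.comp
    ((hr.comp continuous_subtype_val).subtype_mk _)
  have hσr : ∀ γ : P, rng (σ γ : Γ) = rng (γ : Γ) := by
    intro γ
    have := φ.apply_symm_apply ⟨rngUnit γ.1, γ.2⟩
    exact congrArg (fun z : Set.range e => ((z : unitSpace Γ) : Γ)) this
  have hτ : Continuous (fun γ : P => comp (inv (σ γ : Γ)) (γ : Γ) ((src_inv _).trans (hσr γ))) :=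
    continuous_comp_of (TopologicalGroupoid.continuous_inv.comp
      (continuous_subtype_val.comp hσ)) continuous_subtype_val _
  have hEq : setMul U V = Subtype.val '' ((fun γ : P =>
      comp (inv (σ γ : Γ)) (γ : Γ) ((src_inv _).trans (hσr γ))) ⁻¹' V) := by
    ext γ
    constructor
    · rintro ⟨a, ha, b, hb, h, rfl⟩
      have hp : comp a b h ∈ P := ⟨⟨a, ha⟩, Subtype.ext (rng_comp a b h).symm⟩
      refine ⟨⟨comp a b h, hp⟩, ?_, rfl⟩
      have key : (σ ⟨comp a b h, hp⟩ : Γ) = a :=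
        hU.injOn_rng (σ ⟨comp a b h, hp⟩).2 ha ((hσr _).trans (rng_comp a b h))
      have : ∀ (x : Γ) (hx : src (inv x) = rng (comp a b h)), x = a →
          comp (inv x) (comp a b h) hx = b := by
        rintro x hx rfl
        exact inv_comp_comp h
      change comp _ _ _ ∈ V
      rw [this _ _ key]
      exact hb
    · rintro ⟨γ, hγ, rfl⟩
      exact ⟨σ γ, (σ γ).2, _, hγ, _, comp_inv_comp (hσr γ)⟩
  rw [hEq]
  exact hP.isOpenMap_subtype_val _ (hV.preimage hτ)

theorem isCompact_setMul [T2Space Γ] {U V : Set Γ} (hU : IsCompact U) (hV : IsCompact V) :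
    IsCompact (setMul U V) := by
  have hc : IsClosed {p : Γ × Γ | src p.1 = rng p.2} :=
    isClosed_eq (continuous_src.comp continuous_fst) (continuous_rng.comp continuous_snd)
  have hk := hc.isClosedEmbedding_subtypeVal.isCompact_preimage (hU.prod hV)
  have := hk.image TopologicalGroupoid.continuous_comp
  convert this using 1
  ext γ
  constructor
  · rintro ⟨a, ha, b, hb, h, rfl⟩
    exact ⟨⟨(a, b), h⟩, ⟨ha, hb⟩, rfl⟩
  · rintro ⟨⟨⟨a, b⟩, h⟩, ⟨ha, hb⟩, rfl⟩
    exact ⟨a, ha, b, hb, h, rfl⟩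

end Topological

section Ample

variable [AmpleGroupoid Γ]

theorem steinbergSpace_eq_span [T2Space Γ] : steinbergSpace R Γ =
    Submodule.span R {f | ∃ B : Set Γ, IsCompact B ∧ IsOpenBisection B ∧ f = B.indicator 1} := by
  classical
  apply le_antisymm
  · intro f hf
    obtain ⟨C, hsub, hCc, hCo, hC⟩ : ∃ C, Function.support f ⊆ C ∧ IsCompact C ∧ IsOpen C ∧
        ∀ D ⊆ C, IsCompact D → IsOpen D → D.indicator f ∈ Submodule.span R
          {f | ∃ B : Set Γ, IsCompact B ∧ IsOpenBisection B ∧ f = B.indicator 1} := by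
      refine (isCompact_support_of_mem hf).induction_on (p := fun s => ∃ C, s ⊆ C ∧ IsCompact C ∧ IsOpen C ∧
        ∀ D ⊆ C, IsCompact D → IsOpen D → D.indicator f ∈ Submodule.span R
          {f | ∃ B : Set Γ, IsCompact B ∧ IsOpenBisection B ∧ f = B.indicator 1}) ?_ ?_ ?_ ?_
      · refine ⟨∅, subset_rfl, isCompact_empty, isOpen_empty, fun D hD _ _ => ?_⟩
        rw [Set.subset_empty_iff.1 hD, Set.indicator_empty]
        exact zero_mem _
      · rintro s t hst ⟨C, h1, h2⟩
        exact ⟨C, hst.trans h1, h2⟩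
      · rintro s t ⟨C, h1, h2, h3, h4⟩ ⟨C', h1', h2', h3', h4'⟩
        refine ⟨C ∪ C', Set.union_subset_union h1 h1', h2.union h2', h3.union h3', ?_⟩
        intro D hD hDc hDo
        have e : D.indicator f = (D ∩ C).indicator f + (D \ C).indicator f := by
          funext x
          by_cases hx : x ∈ D <;> by_cases hx' : x ∈ C <;> simp [hx, hx']
        rw [e]
        refine add_mem (h4 _ Set.inter_subset_right (hDc.inter_right h2.isClosed)
          (hDo.inter h3)) (h4' _ ?_ (hDc.diff h3) (hDo.sdiff h2.isClosed))
        rintro x ⟨hx, hx'⟩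
        exact (hD hx).resolve_left hx'
      · intro x _
        obtain ⟨B, ⟨hBc, hBb⟩, hxB, hBf⟩ := AmpleGroupoid.basis.exists_subset_of_mem_open
          (a := x) (u := f ⁻¹' {f x}) rfl (hf.1 _)
        refine ⟨B, mem_nhdsWithin_of_mem_nhds (hBb.1.mem_nhds hxB), B, subset_rfl, hBc, hBb.1, ?_⟩
        intro D hD hDc hDo
        have e : D.indicator f = f x • D.indicator 1 := by
          funext y
          by_cases hy : y ∈ D
          · have : f y = f x := hBf (hD hy)
            simp [hy, this]
          · simp [hy]
        rw [e]
        exact Submodule.smul_mem _ _ (Submodule.subset_span ⟨D, hDc, hBb.mono hDo hD, rfl⟩)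
    have := hC C subset_rfl hCc hCo
    rwa [Set.indicator_eq_self.2 hsub] at this
  · rw [Submodule.span_le]
    rintro _ ⟨B, hc, hb, rfl⟩
    exact indicator_mem_steinbergSpace hc hb.1

@[elab_as_elim]
theorem steinbergSpace_induction [T2Space Γ] {P : (f : Γ → R) → f ∈ steinbergSpace R Γ → Prop}
    (bisection : ∀ (B : Set Γ) (hc : IsCompact B) (hb : IsOpenBisection B),
      P (B.indicator 1) (indicator_mem_steinbergSpace hc hb.1))
    (zero : P 0 (zero_mem _))
    (add : ∀ f g hf hg, P f hf → P g hg → P (f + g) (add_mem hf hg))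
    (smul : ∀ (c : R) f hf, P f hf → P (c • f) (Submodule.smul_mem _ c hf))
    {f : Γ → R} (hf : f ∈ steinbergSpace R Γ) : P f hf := by
  have hf' := hf
  rw [steinbergSpace_eq_span] at hf'
  refine Submodule.span_induction (p := fun f _ => ∀ h : f ∈ steinbergSpace R Γ, P f h)
    ?_ (fun _ => zero) ?_ ?_ hf' hf
  · rintro _ ⟨B, hc, hb, rfl⟩ _
    exact bisection B hc hb
  · intro f g hf hg h1 h2 _
    rw [← steinbergSpace_eq_span] at hf hg
    exact add f g hf hg (h1 hf) (h2 hg)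
  · intro c f hf h1 _
    rw [← steinbergSpace_eq_span] at hf
    exact smul c f hf (h1 hf)

theorem finite_support_convolution {f : Γ → R} (hf : f ∈ steinbergSpace R Γ) (g : Γ → R) (γ : Γ) :
    (Function.support fun p : {p : Γ × Γ // ∃ h : src p.1 = rng p.2, comp p.1 p.2 h = γ} =>
      f p.1.1 * g p.1.2).Finite := by
  have h1 : (Function.support f ∩ {a | rng a = rng γ}).Finite := by
    refine (isCompact_support_of_mem hf).induction_on
      (p := fun s => (s ∩ {a | rng a = rng γ}).Finite) ?_ ?_ ?_ ?_
    · simp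
    · intro s t hst ht
      exact ht.subset (Set.inter_subset_inter_left _ hst)
    · intro s t hs ht
      rw [Set.union_inter_distrib_right]
      exact hs.union ht
    · intro x _
      obtain ⟨B, ⟨_, hB⟩, hxB, -⟩ := AmpleGroupoid.basis.exists_subset_of_mem_open
        (Set.mem_univ x) isOpen_univ
      refine ⟨B, mem_nhdsWithin_of_mem_nhds (hB.1.mem_nhds hxB), Set.Subsingleton.finite ?_⟩
      rintro a ⟨ha, ha'⟩ b ⟨hb, hb'⟩
      exact hB.injOn_rng ha hb (ha'.trans hb'.symm)
  refine Set.Finite.of_injOn (f := fun p => p.1.1) ?_ ?_ h1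
  · rintro ⟨⟨a, b⟩, h, e⟩ hp
    refine ⟨fun h0 => hp ?_, ?_⟩
    · simp only at h0
      simp [h0]
    · exact (rng_comp a b h).symm.trans (congrArg rng e)
  · rintro ⟨⟨a, b⟩, h, e⟩ _ ⟨⟨a', b'⟩, h', e'⟩ _ haa
    obtain rfl : a = a' := haa
    obtain rfl := comp_left_cancel h h' (e.trans e'.symm)
    rfl

theorem convolution_add_left {f f' : Γ → R} (hf : f ∈ steinbergSpace R Γ)
    (hf' : f' ∈ steinbergSpace R Γ) (g : Γ → R) :
    convolution (f + f') g = convolution f g + convolution f' g := by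
  funext γ
  simp only [convolution, Pi.add_apply, add_mul]
  exact finsum_add_distrib (finite_support_convolution hf g γ) (finite_support_convolution hf' g γ)

theorem convolution_add_right {f : Γ → R} (hf : f ∈ steinbergSpace R Γ) (g g' : Γ → R) :
    convolution f (g + g') = convolution f g + convolution f g' := by
  funext γ
  simp only [convolution, Pi.add_apply, mul_add]
  exact finsum_add_distrib (finite_support_convolution hf g γ) (finite_support_convolution hf g' γ)

theorem convolution_smul_left (c : R) {f : Γ → R} (hf : f ∈ steinbergSpace R Γ) (g : Γ → R) :
    convolution (c • f) g = c • convolution f g := by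
  funext γ
  simp only [convolution, Pi.smul_apply, smul_eq_mul, mul_assoc]
  exact (mul_finsum' _ c (finite_support_convolution hf g γ)).symm

theorem convolution_smul_right (c : R) {f : Γ → R} (hf : f ∈ steinbergSpace R Γ) (g : Γ → R) :
    convolution f (c • g) = c • convolution f g := by
  funext γ
  simp only [convolution, Pi.smul_apply, smul_eq_mul, mul_left_comm _ c]
  exact (mul_finsum' _ c (finite_support_convolution hf g γ)).symm

variable [T2Space Γ]

theorem convolution_mem {f g : Γ → R} (hf : f ∈ steinbergSpace R Γ) (hg : g ∈ steinbergSpace R Γ) :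
    convolution f g ∈ steinbergSpace R Γ := by
  induction hf using steinbergSpace_induction with
  | bisection B hBc hB =>
    induction hg using steinbergSpace_induction with
    | bisection C hCc hC =>
      rw [convolution_indicator hB.injOn_rng]
      exact indicator_mem_steinbergSpace (isCompact_setMul hBc hCc) (isOpen_setMul hB hC.1)
    | zero => rw [convolution_zero_right]; exact zero_mem _
    | add f g _ _ h1 h2 =>
      rw [convolution_add_right (indicator_mem_steinbergSpace hBc hB.1)]
      exact add_mem h1 h2
    | smul c f _ h =>
      rw [convolution_smul_right c (indicator_mem_steinbergSpace hBc hB.1)]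
      exact Submodule.smul_mem _ c h
  | zero => rw [convolution_zero_left]; exact zero_mem _
  | add f g hf hg h1 h2 =>
    rw [convolution_add_left hf hg]
    exact add_mem h1 h2
  | smul c f hf h =>
    rw [convolution_smul_left c hf]
    exact Submodule.smul_mem _ c h

theorem convolution_assoc {f g k : Γ → R} (hf : f ∈ steinbergSpace R Γ)
    (hg : g ∈ steinbergSpace R Γ) (hk : k ∈ steinbergSpace R Γ) :
    convolution (convolution f g) k = convolution f (convolution g k) := by
  induction hf using steinbergSpace_induction with
  | bisection B hBc hB =>
    have hBm := indicator_mem_steinbergSpace (R := R) hBc hB.1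
    induction hg using steinbergSpace_induction with
    | bisection C hCc hC =>
      have hCm := indicator_mem_steinbergSpace (R := R) hCc hC.1
      have hBCm := convolution_mem hBm hCm
      induction hk using steinbergSpace_induction with
      | bisection D hDc hD =>
        rw [convolution_indicator hB.injOn_rng, convolution_indicator hC.injOn_rng,
          convolution_indicator (injOn_rng_setMul hB.injOn_rng hC.injOn_rng),
          convolution_indicator hB.injOn_rng, setMul_assoc]
      | zero => simp only [convolution_zero_right]
      | add f g _ _ h1 h2 =>
        rw [convolution_add_right hBCm, convolution_add_right hCm, convolution_add_right hBm, h1, h2]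
      | smul c f _ h =>
        rw [convolution_smul_right c hBCm, convolution_smul_right c hCm,
          convolution_smul_right c hBm, h]
    | zero => simp only [convolution_zero_right, convolution_zero_left]
    | add f g hf hg h1 h2 =>
      rw [convolution_add_right hBm, convolution_add_left (convolution_mem hBm hf)
        (convolution_mem hBm hg), convolution_add_left hf hg, convolution_add_right hBm, h1, h2]
    | smul c f hf h =>
      rw [convolution_smul_right c hBm, convolution_smul_left c (convolution_mem hBm hf),
        convolution_smul_left c hf, convolution_smul_right c hBm, h]
  | zero => simp only [convolution_zero_left]
  | add f f' hf hf' h1 h2 =>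
    rw [convolution_add_left hf hf', convolution_add_left (convolution_mem hf hg)
      (convolution_mem hf' hg), convolution_add_left hf hf', h1, h2]
  | smul c f hf h =>
    rw [convolution_smul_left c hf, convolution_smul_left c (convolution_mem hf hg),
      convolution_smul_left c hf, h]

end Ample

end ArrowGroupoid

/-- The Steinberg algebra `A_R(Γ)`: the `R`-module `C_c(Γ, R)`, with convolution as product. -/
def SteinbergAlgebra (R Γ : Type*) [CommRing R] [TopologicalSpace Γ] : Type _ :=
  ↥(steinbergSpace R Γ)

namespace SteinbergAlgebra

open ArrowGroupoid

variable {R Γ : Type*} [CommRing R] [TopologicalSpace Γ]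

instance : AddCommGroup (SteinbergAlgebra R Γ) := inferInstanceAs (AddCommGroup (steinbergSpace R Γ))

instance : Module R (SteinbergAlgebra R Γ) := inferInstanceAs (Module R (steinbergSpace R Γ))

instance : CoeFun (SteinbergAlgebra R Γ) (fun _ => Γ → R) := ⟨Subtype.val⟩

variable [ArrowGroupoid Γ] [AmpleGroupoid Γ] [T2Space Γ]

noncomputable instance : NonUnitalRing (SteinbergAlgebra R Γ) where
  __ := (inferInstance : AddCommGroup (SteinbergAlgebra R Γ))
  mul f g := ⟨convolution f.1 g.1, convolution_mem f.2 g.2⟩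
  left_distrib f g k := Subtype.ext (convolution_add_right f.2 g.1 k.1)
  right_distrib f g k := Subtype.ext (convolution_add_left f.2 g.2 k.1)
  zero_mul f := Subtype.ext (convolution_zero_left f.1)
  mul_zero f := Subtype.ext (convolution_zero_right f.1)
  mul_assoc f g k := Subtype.ext (convolution_assoc f.2 g.2 k.2)

instance : IsScalarTower R (SteinbergAlgebra R Γ) (SteinbergAlgebra R Γ) :=
  ⟨fun c f g => Subtype.ext (convolution_smul_left c f.2 g.1)⟩

instance : SMulCommClass R (SteinbergAlgebra R Γ) (SteinbergAlgebra R Γ) :=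
  ⟨fun c f g => Subtype.ext (convolution_smul_right c f.2 g.1).symm⟩

/-- The homogeneous component `A_R(Γ)_g = {f : supp f ⊆ c⁻¹(g)}` for the grading `c : Γ → G`. -/
def component (R : Type*) {Γ G : Type*} [CommRing R] [TopologicalSpace Γ] (c : Γ → G) (g : G) :
    Submodule R (SteinbergAlgebra R Γ) where
  carrier := {f | Function.support (f : Γ → R) ⊆ c ⁻¹' {g}}
  zero_mem' := by
    intro γ hγ
    exact (hγ rfl).elim
  add_mem' {f f'} hf hf' := (Function.support_add (f : Γ → R) f').trans (Set.union_subset hf hf')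
  smul_mem' r f hf := (Function.support_const_smul_subset r (f : Γ → R)).trans hf

end SteinbergAlgebra

/-- A two-sided ideal `I` is graded, for the homogeneous components `A_g` of a ring `A`, if it is the
(internal) direct sum of the subgroups `I_g = I ∩ A_g`. -/
def IsGradedIdeal {A R G : Type*} [NonUnitalRing A] [CommRing R] [Module R A]
    (𝒜 : G → Submodule R A) (I : TwoSidedIdeal A) : Prop :=
  iSupIndep (fun g => AddSubgroup.ofClass I ⊓ (𝒜 g).toAddSubgroup) ∧
    ⨆ g, AddSubgroup.ofClass I ⊓ (𝒜 g).toAddSubgroup = AddSubgroup.ofClass I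

/-! # Partial actions and their groupoids -/

/-- A partial action of a group `G` on a topological space `X`: open sets `X_g` (the target of
`map g`) and homeomorphisms `φ_g : X_{g⁻¹} → X_g` satisfying the axioms below. Only the values of
`map g` on its source `X_{g⁻¹}` carry information. -/
structure PartialAction (G X : Type*) [Group G] [TopologicalSpace X] where
  map : G → OpenPartialHomeomorph X X
  source_eq : ∀ g, (map g).source = (map g⁻¹).target
  target_one : (map 1).target = Set.univ
  map_one : ∀ x, map 1 x = x
  image_inter : ∀ g h,
    map g '' ((map g⁻¹).target ∩ (map h).target) = (map g).target ∩ (map (g * h)).target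
  map_map : ∀ g h x, x ∈ (map h⁻¹).target ∩ (map (h⁻¹ * g⁻¹)).target →
    map g (map h x) = map (g * h) x

namespace PartialAction

variable {G X : Type*} [Group G] [TopologicalSpace X] (φ : PartialAction G X)

/-- The open set `X_g`. -/
def dom (g : G) : Set X := (φ.map g).target

theorem isOpen_dom (g : G) : IsOpen (φ.dom g) := (φ.map g).open_target

theorem mem_dom_one (x : X) : x ∈ φ.dom 1 := by
  rw [dom, φ.target_one]
  trivial

theorem map_mem {g : G} {x : X} (hx : x ∈ φ.dom g⁻¹) : φ.map g x ∈ φ.dom g :=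
  (φ.map g).map_source (by rw [φ.source_eq]; exact hx)

theorem map_inv_mem {g : G} {x : X} (hx : x ∈ φ.dom g) : φ.map g⁻¹ x ∈ φ.dom g⁻¹ :=
  φ.map_mem (by rwa [inv_inv])

theorem map_inv_map {g : G} {x : X} (hx : x ∈ φ.dom g⁻¹) : φ.map g⁻¹ (φ.map g x) = x := by
  rw [φ.map_map g⁻¹ g x ⟨hx, by rw [inv_inv, inv_mul_cancel]; exact φ.mem_dom_one x⟩,
    inv_mul_cancel, φ.map_one]

theorem map_map_inv {g : G} {x : X} (hx : x ∈ φ.dom g) : φ.map g (φ.map g⁻¹ x) = x := by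
  have := φ.map_inv_map (g := g⁻¹) (x := x) (by rwa [inv_inv])
  rwa [inv_inv] at this

theorem mem_dom_mul {g h : G} {x : X} (hx : x ∈ φ.dom g) (hy : φ.map g⁻¹ x ∈ φ.dom h) :
    x ∈ φ.dom (g * h) := by
  have : x ∈ φ.map g '' (φ.dom g⁻¹ ∩ φ.dom h) :=
    ⟨φ.map g⁻¹ x, ⟨φ.map_inv_mem hx, hy⟩, φ.map_map_inv hx⟩
  exact ((φ.image_inter g h).subset this).2

theorem map_mul_inv {g h : G} {x : X} (hx : x ∈ φ.dom g) (hy : φ.map g⁻¹ x ∈ φ.dom h) :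
    φ.map (g * h)⁻¹ x = φ.map h⁻¹ (φ.map g⁻¹ x) := by
  rw [mul_inv_rev]
  refine (φ.map_map h⁻¹ g⁻¹ x ⟨?_, ?_⟩).symm
  · rwa [inv_inv]
  · rw [inv_inv, inv_inv]
    exact φ.mem_dom_mul hx hy

theorem symm_apply {g : G} {x : X} (hx : x ∈ φ.dom g) : (φ.map g).symm x = φ.map g⁻¹ x := by
  have h1 : (φ.map g).symm x ∈ φ.dom g⁻¹ := by
    have := (φ.map g).map_target hx
    rwa [φ.source_eq] at this
  rw [← φ.map_inv_map h1, (φ.map g).right_inv hx]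

/-- The groupoid `𝒢_X = ⋃_g {g} × X_g`. -/
def Arrows : Type _ := {p : G × X // p.2 ∈ φ.dom p.1}

/-- The groupoid structure of `𝒢_X`: `r(g, x) = (1, x)`, `d(g, x) = (1, φ_{g⁻¹}(x))`,
`(g, x)(h, y) = (gh, x)` and `(g, x)⁻¹ = (g⁻¹, φ_{g⁻¹}(x))`. -/
instance : ArrowGroupoid φ.Arrows where
  src a := ⟨(1, φ.map a.1.1⁻¹ a.1.2), φ.mem_dom_one _⟩
  rng a := ⟨(1, a.1.2), φ.mem_dom_one _⟩
  inv a := ⟨(a.1.1⁻¹, φ.map a.1.1⁻¹ a.1.2), φ.map_inv_mem a.2⟩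
  comp a b h := ⟨(a.1.1 * b.1.1, a.1.2), φ.mem_dom_mul a.2 (by
    have h' : φ.map a.1.1⁻¹ a.1.2 = b.1.2 := congrArg (fun c : φ.Arrows => c.1.2) h
    rw [h']
    exact b.2)⟩
  src_src a := Subtype.ext (Prod.ext rfl (by
    change φ.map 1⁻¹ _ = _
    rw [inv_one, φ.map_one]))
  rng_src a := rfl
  src_rng a := Subtype.ext (Prod.ext rfl (by
    change φ.map 1⁻¹ _ = _
    rw [inv_one, φ.map_one]))
  rng_rng a := rfl
  src_comp a b h := by
    have h' : φ.map a.1.1⁻¹ a.1.2 = b.1.2 := congrArg (fun c : φ.Arrows => c.1.2) h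
    apply Subtype.ext
    apply Prod.ext
    · rfl
    · change φ.map (a.1.1 * b.1.1)⁻¹ a.1.2 = φ.map b.1.1⁻¹ b.1.2
      rw [φ.map_mul_inv a.2 (by rw [h']; exact b.2), h']
  rng_comp a b h := rfl
  assoc a b c h h' := Subtype.ext (Prod.ext (mul_assoc _ _ _) rfl)
  comp_src a := Subtype.ext (Prod.ext (mul_one _) rfl)
  rng_comp_self a := Subtype.ext (Prod.ext (one_mul _) rfl)
  src_inv a := Subtype.ext (Prod.ext rfl (by
    change φ.map a.1.1⁻¹⁻¹ (φ.map a.1.1⁻¹ a.1.2) = a.1.2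
    rw [inv_inv, φ.map_map_inv a.2]))
  rng_inv a := rfl
  inv_comp a := Subtype.ext (Prod.ext (inv_mul_cancel _) rfl)
  comp_inv a := Subtype.ext (Prod.ext (mul_inv_cancel _) rfl)

/-- The canonical cocycle `(g, x) ↦ g`, which makes `𝒢_X` a `G`-graded groupoid. -/
def cocycle (a : φ.Arrows) : G := a.1.1

/-- A set `V` is invariant if every `φ_g` maps `V ∩ X_{g⁻¹}` into `V`. -/
def IsInvariant (V : Set X) : Prop := ∀ g, φ.map g '' (V ∩ φ.dom g⁻¹) ⊆ V

section Restriction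

variable {φ} {V : Set X}

theorem IsInvariant.map_mem (hV : φ.IsInvariant V) {g : G} {v : X} (hv : v ∈ V)
    (hg : v ∈ φ.dom g⁻¹) : φ.map g v ∈ V := hV g ⟨v, ⟨hv, hg⟩, rfl⟩

open Classical in
/-- The map `v ↦ φ_g(v)` on `V`, extended by the identity where `φ_g(v)` is not in `V`. -/
noncomputable def restrictFun (φ : PartialAction G X) (V : Set X) (g : G) (v : V) : V :=
  if h : φ.map g v ∈ V then ⟨φ.map g v, h⟩ else v

theorem coe_restrictFun (hV : φ.IsInvariant V) {g : G} {v : V} (hv : (v : X) ∈ φ.dom g⁻¹) :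
    (restrictFun φ V g v : X) = φ.map g v := by
  rw [restrictFun, dif_pos (hV.map_mem v.2 hv)]

theorem continuousOn_restrictFun (hV : φ.IsInvariant V) (g : G) :
    ContinuousOn (restrictFun φ V g) (Subtype.val ⁻¹' φ.dom g⁻¹) := by
  rw [Topology.IsInducing.subtypeVal.continuousOn_iff]
  have h1 : ContinuousOn (φ.map g) (φ.dom g⁻¹) := by
    have := (φ.map g).continuousOn
    rwa [φ.source_eq] at this
  exact (h1.comp continuous_subtype_val.continuousOn (fun v hv => hv)).congr
    (fun v hv => coe_restrictFun hV hv)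

/-- The restriction `φ|_V = (φ_g, X_g ∩ V, V)` of a partial action to an open invariant set. -/
noncomputable def restrict (φ : PartialAction G X) (V : Set X) (_hVo : IsOpen V)
    (hV : φ.IsInvariant V) : PartialAction G V where
  map g :=
    { toFun := restrictFun φ V g
      invFun := restrictFun φ V g⁻¹
      source := Subtype.val ⁻¹' φ.dom g⁻¹
      target := Subtype.val ⁻¹' φ.dom g
      map_source' := fun v hv => by
        rw [Set.mem_preimage, coe_restrictFun hV hv]
        exact φ.map_mem hv
      map_target' := fun v hv => by
        rw [Set.mem_preimage, coe_restrictFun hV (by rwa [inv_inv])]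
        exact φ.map_inv_mem hv
      left_inv' := fun v hv => by
        have h1 := coe_restrictFun hV hv
        apply Subtype.ext
        rw [coe_restrictFun hV (by rw [inv_inv, h1]; exact φ.map_mem hv), h1, φ.map_inv_map hv]
      right_inv' := fun v hv => by
        have h1 := coe_restrictFun hV (g := g⁻¹) (v := v) (by rwa [inv_inv])
        apply Subtype.ext
        rw [coe_restrictFun hV (by rw [h1]; exact φ.map_inv_mem hv), h1, φ.map_map_inv hv]
      open_source := (φ.isOpen_dom _).preimage continuous_subtype_val
      open_target := (φ.isOpen_dom _).preimage continuous_subtype_val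
      continuousOn_toFun := continuousOn_restrictFun hV g
      continuousOn_invFun := by
        have := continuousOn_restrictFun hV g⁻¹
        rwa [inv_inv] at this }
  source_eq g := rfl
  target_one := by
    ext v
    simpa using φ.mem_dom_one (v : X)
  map_one v := by
    apply Subtype.ext
    change (restrictFun φ V 1 v : X) = v
    rw [coe_restrictFun hV (by rw [inv_one]; exact φ.mem_dom_one _), φ.map_one]
  image_inter g h := by
    ext w
    constructor
    · rintro ⟨v, ⟨hv, hv'⟩, rfl⟩
      have : φ.map g v ∈ φ.dom g ∩ φ.dom (g * h) :=
        (φ.image_inter g h).subset ⟨v, ⟨hv, hv'⟩, rfl⟩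
      rw [← coe_restrictFun hV hv] at this
      exact this
    · rintro ⟨hw, hw'⟩
      obtain ⟨x, ⟨hx, hx'⟩, e⟩ := (φ.image_inter g h).superset ⟨hw, hw'⟩
      have e' : φ.map g⁻¹ w = x := by rw [← e]; exact φ.map_inv_map hx
      have hxV : x ∈ V := by
        rw [← e']
        exact hV.map_mem w.2 (by rw [inv_inv]; exact hw)
      exact ⟨⟨x, hxV⟩, ⟨hx, hx'⟩, Subtype.ext ((coe_restrictFun hV (v := ⟨x, hxV⟩) hx).trans e)⟩
  map_map g h v hv := by
    have h1 : (v : X) ∈ φ.dom h⁻¹ := hv.1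
    have h2 : (v : X) ∈ φ.dom (h⁻¹ * g⁻¹) := hv.2
    have h3 : φ.map h v ∈ φ.dom g⁻¹ := by
      have := ((φ.image_inter h (h⁻¹ * g⁻¹)).subset ⟨v, ⟨h1, h2⟩, rfl⟩).2
      rwa [mul_inv_cancel_left] at this
    apply Subtype.ext
    change (restrictFun φ V g (restrictFun φ V h v) : X) = restrictFun φ V (g * h) v
    rw [coe_restrictFun hV (by rw [coe_restrictFun hV h1]; exact h3), coe_restrictFun hV h1,
      coe_restrictFun hV (by rw [mul_inv_rev]; exact h2), φ.map_map g h v ⟨h1, h2⟩]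

end Restriction

section Topology

set_option linter.unusedSectionVars false

variable [TopologicalSpace G]

/-- The topology of `𝒢_X` is inherited from the product topology of `G × X`. -/
instance : TopologicalSpace φ.Arrows := 
  inferInstanceAs (TopologicalSpace {p : G × X // p.2 ∈ φ.dom p.1})

instance [T2Space G] [T2Space X] : T2Space φ.Arrows :=
  inferInstanceAs (T2Space {p : G × X // p.2 ∈ φ.dom p.1})

theorem continuous_val : Continuous (fun a : φ.Arrows => (a.1 : G × X)) := continuous_subtype_val

theorem continuous_cocycle : Continuous φ.cocycle := continuous_fst.comp φ.continuous_val

variable [DiscreteTopology G]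

theorem isOpenEmbedding_val : Topology.IsOpenEmbedding (fun a : φ.Arrows => (a.1 : G × X)) := by
  refine IsOpen.isOpenEmbedding_subtypeVal (s := {p : G × X | p.2 ∈ φ.dom p.1}) ?_
  have : {p : G × X | p.2 ∈ φ.dom p.1} = ⋃ g, {g} ×ˢ φ.dom g := by
    ext ⟨g, x⟩
    simp
  rw [this]
  exact isOpen_iUnion fun g => (isOpen_discrete _).prod (φ.isOpen_dom g)

theorem continuous_map_inv : Continuous (fun a : φ.Arrows => φ.map a.1.1⁻¹ a.1.2) := by
  rw [continuous_iff_continuousAt]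
  rintro ⟨⟨g, x⟩, hx⟩
  have h1 : ContinuousAt (fun a : φ.Arrows => φ.map g⁻¹ a.1.2) ⟨(g, x), hx⟩ := by
    have h2 : ContinuousAt (φ.map g⁻¹) x := (φ.map g⁻¹).continuousAt (by
      rw [φ.source_eq, inv_inv]; exact hx)
    exact ContinuousAt.comp (f := fun a : φ.Arrows => a.1.2) h2
      (continuous_snd.comp φ.continuous_val).continuousAt
  refine h1.congr ?_
  have : φ.cocycle ⁻¹' {g} ∈ nhds (⟨(g, x), hx⟩ : φ.Arrows) :=
    ((isOpen_discrete _).preimage φ.continuous_cocycle).mem_nhds rfl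
  filter_upwards [this] with a ha
  have : a.1.1 = g := ha
  rw [this]

instance : TopologicalGroupoid φ.Arrows where
  continuous_inv := by
    refine φ.isOpenEmbedding_val.isInducing.continuous_iff.2 ?_
    exact Continuous.prodMk ((continuous_of_discreteTopology (f := fun g : G => g⁻¹)).comp
      φ.continuous_cocycle) φ.continuous_map_inv
  continuous_comp := by
    refine φ.isOpenEmbedding_val.isInducing.continuous_iff.2 ?_
    have h1 := φ.continuous_val.comp (continuous_fst.comp (continuous_subtype_val
      (p := fun p : φ.Arrows × φ.Arrows => ArrowGroupoid.src p.1 = ArrowGroupoid.rng p.2)))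
    have h2 := φ.continuous_val.comp (continuous_snd.comp (continuous_subtype_val
      (p := fun p : φ.Arrows × φ.Arrows => ArrowGroupoid.src p.1 = ArrowGroupoid.rng p.2)))
    exact Continuous.prodMk ((continuous_of_discreteTopology (f := fun p : G × G => p.1 * p.2)).comp
      ((continuous_fst.comp h1).prodMk (continuous_fst.comp h2))) (continuous_snd.comp h1)

open ArrowGroupoid

theorem isOpenMap_rngUnit : IsOpenMap (rngUnit : φ.Arrows → unitSpace φ.Arrows) := by
  intro W hW
  have h1 : IsOpen ((fun a : φ.Arrows => a.1.2) '' W) := by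
    have := isOpenMap_snd _ (φ.isOpenEmbedding_val.isOpenMap W hW)
    rwa [Set.image_image] at this
  have h2 : rngUnit '' W = (fun u : unitSpace φ.Arrows => u.1.1.2) ⁻¹'
      ((fun a : φ.Arrows => a.1.2) '' W) := by
    ext u
    constructor
    · rintro ⟨a, ha, rfl⟩
      exact ⟨a, ha, rfl⟩
    · rintro ⟨a, ha, e⟩
      obtain ⟨_, b, rfl⟩ := u
      exact ⟨a, ha, Subtype.ext (Subtype.ext (Prod.ext rfl e))⟩
  rw [h2]
  exact h1.preimage (continuous_snd.comp (φ.continuous_val.comp continuous_subtype_val))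

theorem isOpenMap_srcUnit : IsOpenMap (srcUnit : φ.Arrows → unitSpace φ.Arrows) := by
  intro W hW
  have h2 : srcUnit '' W = rngUnit '' (inv ⁻¹' W : Set φ.Arrows) := by
    ext u
    constructor
    · rintro ⟨a, ha, rfl⟩
      refine ⟨inv a, ?_, Subtype.ext (rng_inv a)⟩
      have : inv (inv a) = a := Subtype.ext (Prod.ext (inv_inv _) (by
        change φ.map a.1.1⁻¹⁻¹ (φ.map a.1.1⁻¹ a.1.2) = a.1.2
        rw [inv_inv, φ.map_map_inv a.2]))
      rw [Set.mem_preimage, this]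
      exact ha
    · rintro ⟨a, ha, rfl⟩
      exact ⟨inv a, ha, Subtype.ext (src_inv a)⟩
  rw [h2]
  exact φ.isOpenMap_rngUnit _ (hW.preimage TopologicalGroupoid.continuous_inv)

theorem isOpenBisection_of_subset {U : Set φ.Arrows} (hU : IsOpen U) {g : G}
    (hg : U ⊆ φ.cocycle ⁻¹' {g}) : IsOpenBisection U := by
  refine ⟨hU, ?_, ?_⟩
  · refine .of_continuous_injective_isOpenMap
      ((continuous_src.subtype_mk _).comp continuous_subtype_val) ?_
      (φ.isOpenMap_srcUnit.comp hU.isOpenMap_subtype_val)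
    rintro ⟨a, ha⟩ ⟨b, hb⟩ e
    have ha' : a.1.1 = g := hg ha
    have hb' : b.1.1 = g := hg hb
    have e' : φ.map a.1.1⁻¹ a.1.2 = φ.map b.1.1⁻¹ b.1.2 :=
      congrArg (fun u : unitSpace φ.Arrows => u.1.1.2) e
    refine Subtype.ext (Subtype.ext (Prod.ext (ha'.trans hb'.symm) ?_))
    change a.1.2 = b.1.2
    rw [← φ.map_map_inv a.2, ← φ.map_map_inv b.2, e', ha', hb']
  · refine .of_continuous_injective_isOpenMap
      ((continuous_rng.subtype_mk _).comp continuous_subtype_val) ?_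
      (φ.isOpenMap_rngUnit.comp hU.isOpenMap_subtype_val)
    rintro ⟨a, ha⟩ ⟨b, hb⟩ e
    have ha' : a.1.1 = g := hg ha
    have hb' : b.1.1 = g := hg hb
    exact Subtype.ext (Subtype.ext (Prod.ext (ha'.trans hb'.symm)
      (congrArg (fun u : unitSpace φ.Arrows => u.1.1.2) e)))

instance [LocallyCompactSpace X] [T2Space X] [TotallyDisconnectedSpace X] :
    AmpleGroupoid φ.Arrows where
  etale := by
    rw [isLocalHomeomorph_iff_isOpenEmbedding_restrict]
    intro a
    have ho : IsOpen (φ.cocycle ⁻¹' {φ.cocycle a}) :=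
      (isOpen_discrete _).preimage φ.continuous_cocycle
    exact ⟨_, ho.mem_nhds rfl, (φ.isOpenBisection_of_subset ho subset_rfl).2.1⟩
  basis := by
    refine TopologicalSpace.isTopologicalBasis_of_isOpen_of_nhds (fun B hB => hB.2.1) ?_
    intro a U ha hU
    have ho : IsOpen (U ∩ φ.cocycle ⁻¹' {φ.cocycle a}) :=
      hU.inter ((isOpen_discrete _).preimage φ.continuous_cocycle)
    have hW := φ.isOpenEmbedding_val.isOpenMap _ ho
    have hS := hW.preimage (Continuous.prodMk_right a.1.1)
    obtain ⟨C, hCc, hxC, hCS⟩ : ∃ C : Set X, (IsCompact C ∧ IsOpen C) ∧ a.1.2 ∈ C ∧ C ⊆ _ := by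
      obtain ⟨K, hK, hxK, hKS⟩ := exists_compact_subset hS
        (show a.1.2 ∈ _ from ⟨a, ⟨ha, rfl⟩, rfl⟩)
      obtain ⟨C, hC, hxC, hCK⟩ := loc_compact_Haus_tot_disc_of_zero_dim.exists_subset_of_mem_open
        hxK isOpen_interior
      exact ⟨C, ⟨hK.of_isClosed_subset hC.1 (hCK.trans interior_subset), hC.2⟩, hxC,
        (hCK.trans interior_subset).trans hKS⟩
    refine ⟨(fun b : φ.Arrows => (b.1 : G × X)) ⁻¹' ({a.1.1} ×ˢ C), ⟨?_, ?_⟩, ⟨rfl, hxC⟩, ?_⟩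
    · refine φ.isOpenEmbedding_val.isInducing.isCompact_preimage' (isCompact_singleton.prod hCc.1) ?_
      rintro ⟨g, x⟩ ⟨hg, hx⟩
      obtain ⟨b, -, hb⟩ := hCS hx
      obtain rfl : g = a.1.1 := hg
      exact ⟨b, hb⟩
    · refine φ.isOpenBisection_of_subset (g := a.1.1)
        (((isOpen_discrete _).prod hCc.2).preimage φ.continuous_val) ?_
      rintro b ⟨hb, -⟩
      exact hb
    · rintro b ⟨hb, hb'⟩
      obtain ⟨c, hc, hcb⟩ := hCS hb'
      have : c = b := Subtype.ext (hcb.trans (Prod.ext hb.symm rfl))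
      exact this ▸ hc.1

/-! ### The subgroupoid `𝒢_V` and its Steinberg algebra inside that of `𝒢_X` -/

variable {φ} {V : Set X} (hVo : IsOpen V) (hV : φ.IsInvariant V)

/-- The inclusion of `𝒢_V = ⋃_g {g} × (V ∩ X_g)`, the groupoid of `φ|_V`, in `𝒢_X`. -/
def arrowsInclusion (a : (φ.restrict V hVo hV).Arrows) : φ.Arrows := ⟨(a.1.1, a.1.2), a.2⟩

theorem isOpenEmbedding_arrowsInclusion : Topology.IsOpenEmbedding (arrowsInclusion hVo hV) :=
  Topology.IsOpenEmbedding.of_comp _ φ.isOpenEmbedding_val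
    ((Topology.IsOpenEmbedding.id.prodMap hVo.isOpenEmbedding_subtypeVal).comp
      (φ.restrict V hVo hV).isOpenEmbedding_val)

theorem src_arrowsInclusion (a : (φ.restrict V hVo hV).Arrows) :
    src (arrowsInclusion hVo hV a) = arrowsInclusion hVo hV (src a) :=
  Subtype.ext (Prod.ext rfl (coe_restrictFun hV (by rw [inv_inv]; exact a.2)).symm)

theorem rng_arrowsInclusion (a : (φ.restrict V hVo hV).Arrows) :
    rng (arrowsInclusion hVo hV a) = arrowsInclusion hVo hV (rng a) := rfl

theorem setMul_image_arrowsInclusion (B C : Set (φ.restrict V hVo hV).Arrows) :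
    setMul (arrowsInclusion hVo hV '' B) (arrowsInclusion hVo hV '' C) =
      arrowsInclusion hVo hV '' setMul B C := by
  ext γ
  constructor
  · rintro ⟨_, ⟨a, ha, rfl⟩, _, ⟨b, hb, rfl⟩, h, rfl⟩
    have h' : src a = rng b := by
      rw [src_arrowsInclusion, rng_arrowsInclusion] at h
      exact (isOpenEmbedding_arrowsInclusion hVo hV).injective h
    exact ⟨comp a b h', ⟨a, ha, b, hb, h', rfl⟩, rfl⟩
  · rintro ⟨_, ⟨a, ha, b, hb, h, rfl⟩, rfl⟩
    exact ⟨_, ⟨a, ha, rfl⟩, _, ⟨b, hb, rfl⟩, by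
      rw [src_arrowsInclusion, rng_arrowsInclusion, h], rfl⟩

theorem extend_indicator {R : Type*} [CommRing R] (B : Set (φ.restrict V hVo hV).Arrows) :
    Function.extend (arrowsInclusion hVo hV) (B.indicator (1 : (φ.restrict V hVo hV).Arrows → R)) 0 =
      (arrowsInclusion hVo hV '' B).indicator 1 := by
  classical
  have hi := (isOpenEmbedding_arrowsInclusion hVo hV).injective
  funext γ
  by_cases hγ : ∃ a, arrowsInclusion hVo hV a = γ
  · obtain ⟨a, rfl⟩ := hγ
    rw [hi.extend_apply]
    simp [Set.indicator_apply, hi.eq_iff]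
  · rw [Function.extend_apply' _ _ _ hγ, Set.indicator_of_notMem]
    · rfl
    · rintro ⟨a, -, h⟩
      exact hγ ⟨a, h⟩

theorem extend_add' {R : Type*} [CommRing R] (f g : (φ.restrict V hVo hV).Arrows → R) :
    Function.extend (arrowsInclusion hVo hV) (f + g) 0 =
      Function.extend (arrowsInclusion hVo hV) f 0 +
        Function.extend (arrowsInclusion hVo hV) g 0 := by
  have := Function.extend_add (arrowsInclusion hVo hV) f g (0 : φ.Arrows → R) 0
  rwa [add_zero] at this

theorem extend_smul' {R : Type*} [CommRing R] (c : R) (f : (φ.restrict V hVo hV).Arrows → R) :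
    Function.extend (arrowsInclusion hVo hV) (c • f) 0 =
      c • Function.extend (arrowsInclusion hVo hV) f 0 := by
  have := Function.extend_smul c (arrowsInclusion hVo hV) f (0 : φ.Arrows → R)
  rwa [smul_zero] at this

theorem extend_zero' {R : Type*} [CommRing R] :
    Function.extend (arrowsInclusion hVo hV) (0 : (φ.restrict V hVo hV).Arrows → R) 0 = 0 := by
  have := extend_smul' hVo hV (0 : R) 0
  simpa using this

variable [LocallyCompactSpace X] [T2Space X] [TotallyDisconnectedSpace X]

instance : AmpleGroupoid (φ.restrict V hVo hV).Arrows :=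
  haveI := hVo.locallyCompactSpace
  inferInstance

theorem extend_mem {R : Type*} [CommRing R] {f : (φ.restrict V hVo hV).Arrows → R}
    (hf : f ∈ steinbergSpace R (φ.restrict V hVo hV).Arrows) :
    Function.extend (arrowsInclusion hVo hV) f 0 ∈ steinbergSpace R φ.Arrows := by
  have hι := isOpenEmbedding_arrowsInclusion hVo hV
  induction hf using steinbergSpace_induction with
  | bisection B hc hb =>
    rw [extend_indicator]
    exact indicator_mem_steinbergSpace (hc.image hι.continuous) (hι.isOpenMap _ hb.1)
  | zero => rw [extend_zero' hVo hV]; exact zero_mem _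
  | add f g _ _ h1 h2 => rw [extend_add']; exact add_mem h1 h2
  | smul c f _ h => rw [extend_smul']; exact Submodule.smul_mem _ c h

theorem extend_convolution {R : Type*} [CommRing R] {f g : (φ.restrict V hVo hV).Arrows → R}
    (hf : f ∈ steinbergSpace R (φ.restrict V hVo hV).Arrows)
    (hg : g ∈ steinbergSpace R (φ.restrict V hVo hV).Arrows) :
    Function.extend (arrowsInclusion hVo hV) (convolution f g) 0 =
      convolution (Function.extend (arrowsInclusion hVo hV) f 0)
        (Function.extend (arrowsInclusion hVo hV) g 0) := by
  induction hf using steinbergSpace_induction with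
  | bisection B hc hb =>
    have hB := indicator_mem_steinbergSpace (R := R) hc hb.1
    have hB' := extend_mem hVo hV hB
    induction hg using steinbergSpace_induction with
    | bisection C hc' hb' =>
      have hinj : Set.InjOn rng (arrowsInclusion hVo hV '' B) := by
        rintro _ ⟨a, ha, rfl⟩ _ ⟨b, hb', rfl⟩ e
        rw [hb.injOn_rng ha hb' ((isOpenEmbedding_arrowsInclusion hVo hV).injective e)]
      rw [convolution_indicator hb.injOn_rng, extend_indicator, extend_indicator, extend_indicator,
        convolution_indicator hinj, setMul_image_arrowsInclusion]
    | zero => rw [convolution_zero_right, extend_zero' hVo hV, convolution_zero_right]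
    | add g g' hg hg' h1 h2 =>
      rw [convolution_add_right hB, extend_add', extend_add', convolution_add_right hB', h1, h2]
    | smul c g hg h =>
      rw [convolution_smul_right c hB, extend_smul', extend_smul', convolution_smul_right c hB', h]
  | zero => rw [convolution_zero_left, extend_zero' hVo hV, convolution_zero_left]
  | add f f' hf hf' h1 h2 =>
    rw [convolution_add_left hf hf', extend_add', extend_add',
      convolution_add_left (extend_mem hVo hV hf) (extend_mem hVo hV hf'), h1, h2]
  | smul c f hf h =>
    rw [convolution_smul_left c hf, extend_smul', extend_smul',
      convolution_smul_left c (extend_mem hVo hV hf), h]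

/-- Extension by zero, the embedding `A_R(𝒢_V) → A_R(𝒢_X)` by which `A_R(𝒢_V)` is regarded as a
subalgebra of `A_R(𝒢_X)`. -/
noncomputable def extendByZero (R : Type*) [CommRing R] :
    SteinbergAlgebra R (φ.restrict V hVo hV).Arrows →ₙₐ[R] SteinbergAlgebra R φ.Arrows where
  toFun f := ⟨Function.extend (arrowsInclusion hVo hV) f.1 0, extend_mem hVo hV f.2⟩
  map_smul' c f := Subtype.ext (extend_smul' hVo hV c f.1)
  map_zero' := Subtype.ext (extend_zero' hVo hV)
  map_add' f g := Subtype.ext (extend_add' hVo hV f.1 g.1)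
  map_mul' f g := Subtype.ext (extend_convolution hVo hV f.2 g.2)

end Topology

end PartialAction

namespace ArrowGroupoid

variable {R Γ : Type*} [CommRing R] [ArrowGroupoid Γ]

theorem convolution_indicator_comp {U : Set Γ} (hU : Set.InjOn rng U) (f : Γ → R) {a b : Γ}
    (ha : a ∈ U) (h : src a = rng b) :
    convolution (U.indicator 1) f (comp a b h) = f b := by
  classical
  unfold convolution
  rw [finsum_eq_single _ ⟨(a, b), h, rfl⟩]
  · simp [ha]
  · rintro ⟨⟨a', b'⟩, h', e⟩ hne
    by_cases ha' : a' ∈ U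
    · obtain rfl : a' = a := hU ha' ha (by
        rw [← rng_comp a' b' h', ← rng_comp a b h]; exact congrArg rng e)
      obtain rfl : b' = b := comp_left_cancel h' h e
      exact (hne rfl).elim
    · simp [ha']

theorem convolution_ne_zero {f g : Γ → R} {γ : Γ} (h : convolution f g γ ≠ 0) :
    ∃ a b, ∃ h : src a = rng b, f a ≠ 0 ∧ g b ≠ 0 ∧ comp a b h = γ := by
  contrapose! h
  refine finsum_eq_zero_of_forall_eq_zero ?_
  rintro ⟨⟨a, b⟩, h', e⟩
  by_cases ha : f a = 0
  · simp [ha]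
  · by_cases hb : g b = 0
    · simp [hb]
    · exact (h a b h' ha hb e).elim

end ArrowGroupoid

theorem indicator_mem_steinbergSpace_of_isClopen {R Γ : Type*} [CommRing R] [TopologicalSpace Γ]
    {s : Set Γ} (hs : IsClopen s) {f : Γ → R} (hf : f ∈ steinbergSpace R Γ) :
    s.indicator f ∈ steinbergSpace R Γ := by
  classical
  refine ⟨?_, ?_⟩
  · rw [IsLocallyConstant.iff_exists_open]
    intro x
    obtain ⟨U, hU, hxU, h⟩ := (IsLocallyConstant.iff_exists_open f).1 hf.1 x
    by_cases hx : x ∈ s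
    · exact ⟨U ∩ s, hU.inter hs.2, ⟨hxU, hx⟩, fun y hy => by simp [hx, hy.2, h y hy.1]⟩
    · exact ⟨sᶜ, hs.1.isOpen_compl, hx, fun y hy => by
        have hy' : y ∉ s := hy
        simp [hx, hy']⟩
  · refine hf.2.mono fun x hx hx' => hx ?_
    simp [Set.indicator_apply, hx']

namespace PartialAction

open ArrowGroupoid

variable {G X : Type*} [Group G] [TopologicalSpace X] {φ : PartialAction G X}

theorem IsInvariant.rng_mem {V : Set X} (hV : φ.IsInvariant V) (a : φ.Arrows)
    (ha : φ.map a.1.1⁻¹ a.1.2 ∈ V) : a.1.2 ∈ V := by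
  rw [← φ.map_map_inv a.2]
  exact hV.map_mem ha (φ.map_inv_mem a.2)

theorem map_inv_eq_of_src_eq_rng {a b : φ.Arrows} (h : src a = rng b) :
    φ.map a.1.1⁻¹ a.1.2 = b.1.2 :=
  congrArg (fun c : φ.Arrows => c.1.2) h

theorem eq_of_cocycle_eq_of_src_eq {a b : φ.Arrows} (h : φ.cocycle a = φ.cocycle b)
    (e : src a = src b) : a = b := by
  obtain ⟨⟨g, x⟩, hx⟩ := a
  obtain ⟨⟨k, y⟩, hy⟩ := b
  obtain rfl : g = k := h
  have e' : φ.map g⁻¹ x = φ.map g⁻¹ y := congrArg (fun c : φ.Arrows => c.1.2) e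
  have : x = y := by
    have hx' : φ.map g (φ.map g⁻¹ x) = x := φ.map_map_inv hx
    rw [← hx', e']
    exact φ.map_map_inv hy
  subst this
  rfl

variable (φ) in
/-- The units of `𝒢_X` lying over `C ⊆ X`. -/
def unitsOver (C : Set X) : Set φ.Arrows := {a | a.1.1 = 1 ∧ a.1.2 ∈ C}

theorem injOn_rng_unitsOver (C : Set X) : Set.InjOn rng (φ.unitsOver C) := by
  intro a ha b hb e
  have e' := congrArg (fun c : φ.Arrows => c.1.2) e
  exact Subtype.ext (Prod.ext (ha.1.trans hb.1.symm) e')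

theorem convolution_unitsOver {R : Type*} [CommRing R] (C : Set X) (f : φ.Arrows → R) :
    convolution ((φ.unitsOver C).indicator 1) f = {a : φ.Arrows | a.1.2 ∈ C}.indicator f := by
  classical
  funext γ
  by_cases hγ : γ.1.2 ∈ C
  · have h := convolution_indicator_comp (injOn_rng_unitsOver C) f
      (show rng γ ∈ φ.unitsOver C from ⟨rfl, hγ⟩) (src_rng γ)
    rw [rng_comp_self] at h
    rw [h, Set.indicator_of_mem (show γ ∈ {a : φ.Arrows | a.1.2 ∈ C} from hγ)]
  · rw [Set.indicator_of_notMem (show γ ∉ {a : φ.Arrows | a.1.2 ∈ C} from hγ)]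
    by_contra hne
    obtain ⟨a, b, h, ha, -, rfl⟩ := convolution_ne_zero hne
    exact hγ (Set.mem_of_indicator_ne_zero ha).2

variable [TopologicalSpace G] [DiscreteTopology G]

theorem isClopen_cocycle_preimage (φ : PartialAction G X) (s : Set G) :
    IsClopen (φ.cocycle ⁻¹' s) :=
  (isClopen_discrete s).preimage φ.continuous_cocycle

theorem isOpen_unitsOver {C : Set X} (hC : IsOpen C) : IsOpen (φ.unitsOver C) :=
  ((isOpen_discrete {1}).preimage φ.continuous_cocycle).inter
    (hC.preimage (continuous_snd.comp φ.continuous_val))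

theorem isCompact_unitsOver {C : Set X} (hC : IsCompact C) : IsCompact (φ.unitsOver C) := by
  have : φ.unitsOver C = (fun a : φ.Arrows => (a.1 : G × X)) ⁻¹' ({1} ×ˢ C) := rfl
  rw [this]
  refine φ.isOpenEmbedding_val.isInducing.isCompact_preimage' (isCompact_singleton.prod hC) ?_
  rintro ⟨g, x⟩ ⟨hg, -⟩
  obtain rfl : g = 1 := hg
  exact ⟨⟨(1, x), φ.mem_dom_one x⟩, rfl⟩

section Ample

set_option linter.unusedSectionVars false

variable [LocallyCompactSpace X] [T2Space X] [TotallyDisconnectedSpace X]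

variable {R : Type*} [CommRing R]

variable (φ R) in
/-- The characteristic function of a compact open set of units. -/
noncomputable def unitIndicator (C : Set X) (hc : IsCompact C) (ho : IsOpen C) :
    SteinbergAlgebra R φ.Arrows :=
  ⟨(φ.unitsOver C).indicator 1,
    indicator_mem_steinbergSpace (isCompact_unitsOver hc) (isOpen_unitsOver ho)⟩

theorem exists_isCompact_isOpen_subset {U : Set X} (hU : IsOpen U) {x : X} (hx : x ∈ U) :
    ∃ C : Set X, IsCompact C ∧ IsOpen C ∧ x ∈ C ∧ C ⊆ U := by
  obtain ⟨K, hK, hxK, hKU⟩ := exists_compact_subset hU hx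
  obtain ⟨C, hC, hxC, hCK⟩ := loc_compact_Haus_tot_disc_of_zero_dim.exists_subset_of_mem_open
    hxK isOpen_interior
  exact ⟨C, hK.of_isClosed_subset hC.1 (hCK.trans interior_subset), hC.2, hxC,
    (hCK.trans interior_subset).trans hKU⟩

variable (φ) in
/-- The restriction of an element of the Steinberg algebra to the arrows of degree `g`. -/
noncomputable def homogeneousPart (g : G) (f : SteinbergAlgebra R φ.Arrows) :
    SteinbergAlgebra R φ.Arrows :=
  ⟨(φ.cocycle ⁻¹' {g}).indicator f,
    indicator_mem_steinbergSpace_of_isClopen (φ.isClopen_cocycle_preimage {g}) f.2⟩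

theorem homogeneousPart_add (g : G) (f f' : SteinbergAlgebra R φ.Arrows) :
    φ.homogeneousPart g (f + f') = φ.homogeneousPart g f + φ.homogeneousPart g f' :=
  Subtype.ext (Set.indicator_add _ f.1 f'.1)

theorem homogeneousPart_mem_component (g : G) (f : SteinbergAlgebra R φ.Arrows) :
    φ.homogeneousPart g f ∈ SteinbergAlgebra.component R φ.cocycle g :=
  Set.support_indicator_subset

theorem homogeneousPart_of_mem {g : G} {f : SteinbergAlgebra R φ.Arrows}
    (hf : f ∈ SteinbergAlgebra.component R φ.cocycle g) : φ.homogeneousPart g f = f :=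
  Subtype.ext (Set.indicator_eq_self.2 hf)

theorem homogeneousPart_of_ne {g h : G} (hgh : g ≠ h) {f : SteinbergAlgebra R φ.Arrows}
    (hf : f ∈ SteinbergAlgebra.component R φ.cocycle g) : φ.homogeneousPart h f = 0 := by
  refine Subtype.ext (Set.indicator_eq_zero'.2 (Set.disjoint_left.2 fun a ha ha' => hgh ?_))
  exact (show φ.cocycle a = g from hf ha).symm.trans ha'

theorem exists_sum_homogeneousPart (f : SteinbergAlgebra R φ.Arrows) :
    ∃ s : Finset G, ∑ g ∈ s, φ.homogeneousPart g f = f := by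
  classical
  have hs : (φ.cocycle '' Function.support f.1).Finite :=
    ((isCompact_support_of_mem f.2).image φ.continuous_cocycle).finite_of_discrete
  refine ⟨hs.toFinset, Subtype.ext ?_⟩
  have h1 : (∑ g ∈ hs.toFinset, φ.homogeneousPart g f).1 =
      ∑ g ∈ hs.toFinset, (φ.homogeneousPart g f).1 :=
    map_sum (steinbergSpace R φ.Arrows).subtype _ _
  rw [h1]
  funext a
  rw [Finset.sum_apply, Finset.sum_eq_single (φ.cocycle a)]
  · exact Set.indicator_of_mem (show a ∈ φ.cocycle ⁻¹' {φ.cocycle a} from rfl) _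
  · intro g _ hg
    exact Set.indicator_of_notMem (show a ∉ φ.cocycle ⁻¹' {g} from fun h => hg (Eq.symm h)) _
  · intro ha
    have : f.1 a = 0 := by
      by_contra h
      exact ha (hs.mem_toFinset.2 ⟨a, h, rfl⟩)
    exact Set.indicator_apply_eq_zero.2 fun _ => this

theorem homogeneousPart_mem {I : TwoSidedIdeal (SteinbergAlgebra R φ.Arrows)}
    (hI : IsGradedIdeal (SteinbergAlgebra.component R φ.cocycle) I) (h : G)
    {f : SteinbergAlgebra R φ.Arrows} (hf : f ∈ I) : φ.homogeneousPart h f ∈ I := by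
  have hf' : f ∈ AddSubgroup.ofClass I := hf
  rw [← hI.2] at hf'
  refine AddSubgroup.iSup_induction _ (C := fun f => φ.homogeneousPart h f ∈ I) hf' ?_ ?_ ?_
  · rintro g f ⟨h1, h2⟩
    by_cases hgh : g = h
    · subst hgh
      rw [homogeneousPart_of_mem h2]
      exact h1
    · rw [homogeneousPart_of_ne hgh h2]
      exact I.zero_mem
  · have : φ.homogeneousPart h (0 : SteinbergAlgebra R φ.Arrows) = 0 :=
      Subtype.ext (Set.indicator_zero' _)
    rw [this]
    exact I.zero_mem
  · intro f f' h1 h2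
    rw [homogeneousPart_add]
    exact I.add_mem h1 h2

theorem isGradedIdeal_of_homogeneousPart_mem {I : TwoSidedIdeal (SteinbergAlgebra R φ.Arrows)}
    (hI : ∀ f ∈ I, ∀ g, φ.homogeneousPart g f ∈ I) :
    IsGradedIdeal (SteinbergAlgebra.component R φ.cocycle) I := by
  refine ⟨?_, le_antisymm (iSup_le fun g => inf_le_left) ?_⟩
  · intro g
    rw [AddSubgroup.disjoint_def]
    intro f hf hf'
    rw [← homogeneousPart_of_mem (φ := φ) hf.2]
    refine AddSubgroup.iSup_induction _ (C := fun f => φ.homogeneousPart g f = 0) hf' ?_ ?_ ?_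
    · intro k f hfk
      by_cases hk : k = g
      · simp only [hk, ne_eq, not_true_eq_false, iSup_false, AddSubgroup.mem_bot] at hfk
        rw [hfk]
        exact Subtype.ext (Set.indicator_zero' _)
      · simp only [ne_eq, hk, not_false_eq_true, iSup_pos] at hfk
        exact homogeneousPart_of_ne hk hfk.2
    · exact Subtype.ext (Set.indicator_zero' _)
    · intro f f' h1 h2
      rw [homogeneousPart_add, h1, h2, add_zero]
  · intro f hf
    obtain ⟨s, hs⟩ := exists_sum_homogeneousPart f
    rw [← hs]
    refine sum_mem fun g _ => ?_
    exact AddSubgroup.mem_iSup_of_mem g ⟨hI f hf g, homogeneousPart_mem_component g f⟩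

variable (R) in
/-- The ideal of the functions that vanish at all arrows whose range lies outside an invariant
set `V`. -/
noncomputable def idealOver {V : Set X} (hV : φ.IsInvariant V) :
    TwoSidedIdeal (SteinbergAlgebra R φ.Arrows) :=
  .mk' {f | ∀ a : φ.Arrows, f.1 a ≠ 0 → a.1.2 ∈ V}
    (fun _ h => (h rfl).elim)
    (fun {f f'} hf hf' a h => by
      by_cases h1 : f.1 a = 0
      · refine hf' a fun h2 => h ?_
        change f.1 a + f'.1 a = 0
        rw [h1, h2, add_zero]
      · exact hf a h1)
    (fun {f} hf a h => hf a fun h0 => h (by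
      change -f.1 a = 0
      rw [h0, neg_zero]))
    (fun {f f'} hf' γ h => by
      obtain ⟨a, b, hab, -, hb, rfl⟩ := convolution_ne_zero (f := f.1) (g := f'.1) h
      refine hV.rng_mem a ?_
      rw [map_inv_eq_of_src_eq_rng hab]
      exact hf' b hb)
    (fun {f f'} hf γ h => by
      obtain ⟨a, b, hab, ha, -, rfl⟩ := convolution_ne_zero (f := f.1) (g := f'.1) h
      exact hf a ha)

theorem mem_idealOver {V : Set X} (hV : φ.IsInvariant V) {f : SteinbergAlgebra R φ.Arrows} :
    f ∈ idealOver R hV ↔ ∀ a : φ.Arrows, f.1 a ≠ 0 → a.1.2 ∈ V :=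
  TwoSidedIdeal.mem_mk' _ _ _ _ _ _ _

theorem isGradedIdeal_idealOver {V : Set X} (hV : φ.IsInvariant V) :
    IsGradedIdeal (SteinbergAlgebra.component R φ.cocycle) (idealOver R hV) := by
  refine isGradedIdeal_of_homogeneousPart_mem fun f hf g => ?_
  rw [mem_idealOver] at hf ⊢
  intro a ha
  exact hf a fun h0 => ha (Set.indicator_apply_eq_zero.2 fun _ => h0)

theorem coe_idealOver {V : Set X} (hVo : IsOpen V) (hV : φ.IsInvariant V) :
    (idealOver R hV : Set (SteinbergAlgebra R φ.Arrows)) = Set.range (extendByZero hVo hV R) := by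
  have hι := isOpenEmbedding_arrowsInclusion hVo hV
  ext f
  rw [SetLike.mem_coe, mem_idealOver]
  constructor
  · intro hf
    have hr : Function.support f.1 ⊆ Set.range (arrowsInclusion hVo hV) :=
      fun a ha => ⟨⟨(a.1.1, ⟨a.1.2, hf a ha⟩), a.2⟩, rfl⟩
    refine ⟨⟨f.1 ∘ arrowsInclusion hVo hV, f.2.1.comp_continuous hι.continuous, ?_⟩,
      Subtype.ext ?_⟩
    · refine HasCompactSupport.intro (K := arrowsInclusion hVo hV ⁻¹' Function.support f.1)
        (hι.isInducing.isCompact_preimage' (isCompact_support_of_mem f.2) hr) ?_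
      intro a ha
      exact Function.notMem_support.1 ha
    · funext a
      change Function.extend _ _ _ a = _
      by_cases ha : ∃ b, arrowsInclusion hVo hV b = a
      · obtain ⟨b, rfl⟩ := ha
        rw [hι.injective.extend_apply]
        rfl
      · rw [Function.extend_apply' _ _ _ ha]
        exact (Function.notMem_support.1 fun h => ha (hr h)).symm
  · rintro ⟨f, rfl⟩ a ha
    by_contra h
    refine ha (Function.extend_apply' _ _ _ ?_)
    rintro ⟨b, rfl⟩
    exact h b.1.2.2

theorem unitIndicator_mul_apply {C : Set X} (hc : IsCompact C) (ho : IsOpen C)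
    (f : SteinbergAlgebra R φ.Arrows) :
    (φ.unitIndicator R C hc ho * f).1 = {a : φ.Arrows | a.1.2 ∈ C}.indicator f.1 :=
  convolution_unitsOver C f.1

theorem unitIndicator_mul_eq_self {C : Set X} (hc : IsCompact C) (ho : IsOpen C)
    {f : SteinbergAlgebra R φ.Arrows} (hf : ∀ a : φ.Arrows, f.1 a ≠ 0 → a.1.2 ∈ C) :
    φ.unitIndicator R C hc ho * f = f :=
  Subtype.ext ((unitIndicator_mul_apply hc ho f).trans (Set.indicator_eq_self.2 hf))

theorem unitIndicator_union_mem {I : TwoSidedIdeal (SteinbergAlgebra R φ.Arrows)} {C D : Set X}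
    {hc : IsCompact C} {ho : IsOpen C} {hc' : IsCompact D} {ho' : IsOpen D}
    (hC : φ.unitIndicator R C hc ho ∈ I) (hD : φ.unitIndicator R D hc' ho' ∈ I) :
    φ.unitIndicator R (C ∪ D) (hc.union hc') (ho.union ho') ∈ I := by
  classical
  have e : φ.unitIndicator R (C ∪ D) (hc.union hc') (ho.union ho') =
      φ.unitIndicator R C hc ho + φ.unitIndicator R D hc' ho' -
        φ.unitIndicator R C hc ho * φ.unitIndicator R D hc' ho' := by
    apply Subtype.ext
    funext a
    change _ = (φ.unitIndicator R C hc ho).1 a + (φ.unitIndicator R D hc' ho').1 a -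
      (φ.unitIndicator R C hc ho * φ.unitIndicator R D hc' ho').1 a
    rw [unitIndicator_mul_apply]
    by_cases h1 : a.1.1 = 1 <;> by_cases h2 : a.1.2 ∈ C <;> by_cases h3 : a.1.2 ∈ D <;>
      simp [unitIndicator, unitsOver, h1, h2, h3]
  rw [e]
  exact I.sub_mem (I.add_mem hC hD) (I.mul_mem_left _ _ hD)

variable (φ) in
/-- The set of the ranges of the arrows at which some element of `I` does not vanish. -/
def rangeSupport (I : TwoSidedIdeal (SteinbergAlgebra R φ.Arrows)) : Set X :=
  {x | ∃ f ∈ I, ∃ a : φ.Arrows, f.1 a ≠ 0 ∧ a.1.2 = x}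

theorem isOpenMap_snd_val : IsOpenMap (fun a : φ.Arrows => a.1.2) :=
  isOpenMap_snd.comp φ.isOpenEmbedding_val.isOpenMap

theorem isOpen_rangeSupport (I : TwoSidedIdeal (SteinbergAlgebra R φ.Arrows)) :
    IsOpen (φ.rangeSupport I) := by
  have : φ.rangeSupport I =
      ⋃ f ∈ I, (fun a : φ.Arrows => a.1.2) '' Function.support f.1 := by
    ext x
    simp [rangeSupport]
  rw [this]
  refine isOpen_biUnion fun f _ => isOpenMap_snd_val _ ?_
  exact f.2.1 {0}ᶜ

theorem isInvariant_rangeSupport (I : TwoSidedIdeal (SteinbergAlgebra R φ.Arrows)) :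
    φ.IsInvariant (φ.rangeSupport I) := by
  rintro g _ ⟨_, ⟨⟨f, hf, b, hb, rfl⟩, hg⟩, rfl⟩
  let a : φ.Arrows := ⟨(g, φ.map g b.1.2), φ.map_mem hg⟩
  have hab : src a = rng b := Subtype.ext (Prod.ext rfl (φ.map_inv_map hg))
  obtain ⟨B, ⟨hBc, hB⟩, haB, -⟩ := AmpleGroupoid.basis.exists_subset_of_mem_open
    (Set.mem_univ a) isOpen_univ
  let u : SteinbergAlgebra R φ.Arrows := ⟨B.indicator 1, indicator_mem_steinbergSpace hBc hB.1⟩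
  refine ⟨u * f, I.mul_mem_left _ _ hf, comp a b hab, ?_, rfl⟩
  have : (u * f).1 (comp a b hab) = f.1 b := convolution_indicator_comp hB.injOn_rng f.1 haB hab
  rwa [this]

theorem exists_unitIndicator_mem {K : Type*} [Field K]
    {I : TwoSidedIdeal (SteinbergAlgebra K φ.Arrows)}
    (hI : IsGradedIdeal (SteinbergAlgebra.component K φ.cocycle) I) {x : X}
    (hx : x ∈ φ.rangeSupport I) :
    ∃ (C : Set X) (hc : IsCompact C) (ho : IsOpen C), x ∈ C ∧ φ.unitIndicator K C hc ho ∈ I := by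
  classical
  obtain ⟨f, hf, a, ha, rfl⟩ := hx
  obtain ⟨B, ⟨hBc, hB⟩, haB, hBf⟩ := AmpleGroupoid.basis.exists_subset_of_mem_open
    (a := a) (u := f.1 ⁻¹' {f.1 a} ∩ φ.cocycle ⁻¹' {φ.cocycle a}) ⟨rfl, rfl⟩
    ((f.2.1 _).inter (φ.isClopen_cocycle_preimage _).2)
  have hinv : ∀ b : φ.Arrows, inv (inv b) = b := fun b =>
    Subtype.ext (Prod.ext (inv_inv _) (by
      change φ.map b.1.1⁻¹⁻¹ (φ.map b.1.1⁻¹ b.1.2) = b.1.2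
      rw [inv_inv, φ.map_map_inv b.2]))
  have hic : IsCompact (inv ⁻¹' B : Set φ.Arrows) := by
    convert hBc.image TopologicalGroupoid.continuous_inv using 1
    exact (congrFun (Set.image_eq_preimage_of_inverse hinv hinv) B).symm
  have hio : IsOpen (inv ⁻¹' B : Set φ.Arrows) :=
    hB.1.preimage TopologicalGroupoid.continuous_inv
  let u : SteinbergAlgebra K φ.Arrows :=
    ⟨(inv ⁻¹' B).indicator 1, indicator_mem_steinbergSpace hic hio⟩
  have hc : IsCompact ((fun b : φ.Arrows => b.1.2) '' B) :=
    hBc.image (continuous_snd.comp φ.continuous_val)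
  have ho : IsOpen ((fun b : φ.Arrows => b.1.2) '' B) := isOpenMap_snd_val _ hB.1
  refine ⟨_, hc, ho, ⟨a, haB, rfl⟩, ?_⟩
  have key : φ.homogeneousPart (φ.cocycle a) f * ((f.1 a)⁻¹ • u) =
      φ.unitIndicator K _ hc ho := by
    rw [mul_smul_comm]
    apply Subtype.ext
    funext γ
    change (f.1 a)⁻¹ * convolution ((φ.cocycle ⁻¹' {φ.cocycle a}).indicator f.1)
      ((inv ⁻¹' B).indicator 1) γ = (φ.unitsOver _).indicator 1 γ
    have hmem : ∀ b c : φ.Arrows, ∀ h : src b = rng c,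
        (φ.cocycle ⁻¹' {φ.cocycle a}).indicator f.1 b ≠ 0 →
        ((inv ⁻¹' B).indicator 1 : φ.Arrows → K) c ≠ 0 → b ∈ B ∧ c = inv b := by
      intro b c h hb hc'
      have hb' : b ∈ φ.cocycle ⁻¹' {φ.cocycle a} := Set.mem_of_indicator_ne_zero hb
      have hcB : c ∈ inv ⁻¹' B := Set.mem_of_indicator_ne_zero hc'
      have : b = inv c := eq_of_cocycle_eq_of_src_eq
        (hb'.trans (hBf hcB).2.symm) (h.trans (src_inv c).symm)
      rw [this, hinv]
      exact ⟨hcB, rfl⟩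
    by_cases hγ : γ ∈ φ.unitsOver ((fun b : φ.Arrows => b.1.2) '' B)
    · obtain ⟨h1, b, hbB, hb⟩ := hγ
      have hbγ : comp b (inv b) (rng_inv b).symm = γ := by
        rw [comp_inv]
        exact Subtype.ext (Prod.ext h1.symm hb)
      rw [Set.indicator_of_mem
        (show γ ∈ φ.unitsOver ((fun b : φ.Arrows => b.1.2) '' B) from ⟨h1, b, hbB, hb⟩)]
      unfold convolution
      rw [finsum_eq_single _ ⟨(b, inv b), _, hbγ⟩]
      · have hfb : f.1 b = f.1 a := (hBf hbB).1
        have e1 : (φ.cocycle ⁻¹' {φ.cocycle a}).indicator f.1 b = f.1 a :=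
          (Set.indicator_of_mem (hBf hbB).2 _).trans hfb
        have hb' : inv b ∈ (inv ⁻¹' B : Set φ.Arrows) :=
          show inv (inv b) ∈ B from (hinv b).symm ▸ hbB
        have e2 : (inv ⁻¹' B).indicator (1 : φ.Arrows → K) (inv b) = 1 :=
          Set.indicator_of_mem hb' _
        change (f.1 a)⁻¹ * ((φ.cocycle ⁻¹' {φ.cocycle a}).indicator f.1 b *
          (inv ⁻¹' B).indicator 1 (inv b)) = 1
        rw [e1, e2, mul_one, inv_mul_cancel₀ ha]
      · rintro ⟨⟨b', c⟩, h, e⟩ hne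
        by_contra h0
        obtain ⟨hb', hc'⟩ := hmem b' c h (left_ne_zero_of_mul h0) (right_ne_zero_of_mul h0)
        have : b' = b := hB.injOn_rng hb' hbB (by
          have := congrArg rng (e.trans hbγ.symm)
          rwa [rng_comp, rng_comp] at this)
        exact hne (Subtype.ext (Prod.ext this (hc'.trans (congrArg inv this))))
    · rw [Set.indicator_of_notMem hγ]
      by_contra h0
      obtain ⟨b, c, h, hb, hc', e⟩ := convolution_ne_zero (right_ne_zero_of_mul h0)
      obtain ⟨hbB, rfl⟩ := hmem b c h hb hc'
      refine hγ ⟨?_, b, hbB, ?_⟩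
      · rw [← e, comp_inv]
        rfl
      · rw [← e]
        rfl
  rw [← key]
  exact I.mul_mem_right _ _ (homogeneousPart_mem hI _ hf)

theorem exists_unitIndicator_mem_of_subset {K : Type*} [Field K] {I : TwoSidedIdeal (SteinbergAlgebra K φ.Arrows)}
    (hI : IsGradedIdeal (SteinbergAlgebra.component K φ.cocycle) I) {D : Set X}
    (hD : IsCompact D) (hDI : D ⊆ φ.rangeSupport I) :
    ∃ (C : Set X) (hc : IsCompact C) (ho : IsOpen C), D ⊆ C ∧ φ.unitIndicator K C hc ho ∈ I := by
  refine hD.induction_on (p := fun D => ∃ (C : Set X) (hc : IsCompact C) (ho : IsOpen C),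
    D ⊆ C ∧ φ.unitIndicator K C hc ho ∈ I) ?_ ?_ ?_ ?_
  · refine ⟨∅, isCompact_empty, isOpen_empty, subset_rfl, ?_⟩
    convert I.zero_mem
    refine Subtype.ext (Set.indicator_eq_zero'.2 (Set.disjoint_left.2 ?_))
    rintro a - ⟨-, h⟩
    exact h
  · rintro s t hst ⟨C, hc, ho, h, h'⟩
    exact ⟨C, hc, ho, hst.trans h, h'⟩
  · rintro s t ⟨C, hc, ho, h, h'⟩ ⟨C', hc', ho', k, k'⟩
    exact ⟨C ∪ C', hc.union hc', ho.union ho', Set.union_subset_union h k,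
      unitIndicator_union_mem h' k'⟩
  · intro x hx
    obtain ⟨C, hc, ho, hxC, h⟩ := exists_unitIndicator_mem hI (hDI hx)
    exact ⟨C, mem_nhdsWithin_of_mem_nhds (ho.mem_nhds hxC), C, hc, ho, subset_rfl, h⟩

theorem idealOver_rangeSupport {K : Type*} [Field K]
    {I : TwoSidedIdeal (SteinbergAlgebra K φ.Arrows)}
    (hI : IsGradedIdeal (SteinbergAlgebra.component K φ.cocycle) I) :
    idealOver K (isInvariant_rangeSupport I) = I := by
  ext f
  rw [mem_idealOver]
  refine ⟨fun hf => ?_, fun hf a ha => ⟨f, hf, a, ha, rfl⟩⟩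
  obtain ⟨C, hc, ho, hDC, hC⟩ := exists_unitIndicator_mem_of_subset hI
    ((isCompact_support_of_mem f.2).image (continuous_snd.comp φ.continuous_val))
    (by rintro _ ⟨a, ha, rfl⟩; exact hf a ha)
  rw [← unitIndicator_mul_eq_self hc ho (fun a ha => hDC ⟨a, ha, rfl⟩)]
  exact I.mul_mem_right _ _ hC

theorem rangeSupport_idealOver [Nontrivial R] {V : Set X} (hVo : IsOpen V) (hV : φ.IsInvariant V) :
    φ.rangeSupport (idealOver R hV) = V := by
  ext x
  constructor
  · rintro ⟨f, hf, a, ha, rfl⟩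
    exact (mem_idealOver hV).1 hf a ha
  · intro hx
    obtain ⟨C, hc, ho, hxC, hCV⟩ := exists_isCompact_isOpen_subset hVo hx
    let a : φ.Arrows := ⟨(1, x), φ.mem_dom_one x⟩
    have ha : a ∈ φ.unitsOver C := ⟨rfl, hxC⟩
    have h1 : (φ.unitIndicator R C hc ho).1 a = 1 := Set.indicator_of_mem ha _
    refine ⟨φ.unitIndicator R C hc ho, (mem_idealOver hV).2 fun a ha => ?_, a, ?_, rfl⟩
    · exact hCV (Set.mem_of_indicator_ne_zero ha).2
    · rw [h1]
      exact one_ne_zero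

variable (φ) in
/-- Open invariant subsets of `X` correspond to graded ideals of the Steinberg algebra. -/
noncomputable def openInvariantEquivGradedIdeal (K : Type*) [Field K] :
    {V : Set X // IsOpen V ∧ φ.IsInvariant V} ≃
      {I : TwoSidedIdeal (SteinbergAlgebra K φ.Arrows) //
        IsGradedIdeal (SteinbergAlgebra.component K φ.cocycle) I} where
  toFun V := ⟨idealOver K V.2.2, isGradedIdeal_idealOver V.2.2⟩
  invFun I := ⟨φ.rangeSupport I.1, isOpen_rangeSupport I.1, isInvariant_rangeSupport I.1⟩
  left_inv V := Subtype.ext (rangeSupport_idealOver V.2.1 V.2.2)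
  right_inv I := Subtype.ext (idealOver_rangeSupport I.2)

end Ample

end PartialAction

theorem mainTheorem4 {G X K : Type*} [Group G] [TopologicalSpace G] [DiscreteTopology G]
    [TopologicalSpace X] [LocallyCompactSpace X] [T2Space X] [TotallyDisconnectedSpace X]
    [Field K] (φ : PartialAction G X) (hφ : ∀ g, IsClopen (φ.dom g)) :
    ∃ e : {V : Set X // IsOpen V ∧ φ.IsInvariant V} ≃
        {I : TwoSidedIdeal (SteinbergAlgebra K φ.Arrows) //
          IsGradedIdeal (SteinbergAlgebra.component K φ.cocycle) I},
      ∀ V, ((e V).1 : Set (SteinbergAlgebra K φ.Arrows)) =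
        Set.range (PartialAction.extendByZero V.2.1 V.2.2 K) :=
  ⟨φ.openInvariantEquivGradedIdeal K, fun V => PartialAction.coe_idealOver V.2.1 V.2.2⟩
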